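/- Let $E$ be a complex Banach space, $U\subseteq E$ an open set, and $v\colon U\to(0,\infty)$ a continuous function. For a complex Banach space $F$, let $\mathcal H^\infty_v(U,F)$ be the space of all holomorphic maps $f\colon U\to F$ with $$\|f\|_v:=\sup\{v(x)\|f(x)\|\colon x\in U\}<\infty,$$ endowed with the norm $\|\cdot\|_v$, and put $\mathcal H^\infty_v(U):=\mathcal H^\infty_v(U,\mathbb C)$. The $v$-range of $f\colon U\to F$ is the set $(vf)(U)=\{v(x)f(x)\colon x\in U\}$, and $f\in\mathcal H^\infty_v(U,F)$ is said to have finite-dimensional $v$-rank if the linear hull of $(vf)(U)$ is finite-dimensional. A complex Banach space $X$ has the approximation property if for every compact set $K\subseteq X$ and every $\varepsilon>0$ there is a bounded linear operator $T\colon X\to X$ of finite rank with $\|T(x)-x\|<\varepsilon$ for all $x\in K$. Then the following are equivalent: (a) $\mathcal H^\infty_v(U)$ has the approximation property. (b) For every complex Banach space $F$ and every holomorphic map $f\colon U\to F$ whose $v$-range $(vf)(U)$ is relatively compact in $F$, one has $f\in\mathcal H^\infty_v(U,F)$ and there is a sequence $(f_n)$ in $\mathcal H^\infty_v(U,F)$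 of maps with finite-dimensional $v$-rank such that $\|f_n-f\|_v\to0$ as $n\to\infty$. -/

import Mathlib

open Filter Topology TopologicalSpace

universe u w

/-- A weight on an open set `U`: a strictly positive continuous real function on `U`. -/
structure Weight {E : Type*} [TopologicalSpace E] (U : Opens E) where
  toFun : U → ℝ
  continuous_toFun : Continuous toFun
  pos : ∀ x, 0 < toFun x

/-- `f : U → F` is holomorphic: it is the restriction to `U` of a map that is complex
(Fréchet) differentiable at each point of the open set `U`. -/
def IsHolomorphic {E F : Type*} [NormedAddCommGroup E] [NormedSpace ℂ E]
    [NormedAddCommGroup F] [NormedSpace ℂ F] {U : Opens E} (f : U → F) : Prop :=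
  ∃ g : E → F, DifferentiableOn ℂ g (U : Set E) ∧ ∀ x : U, g x = f x

section Space

variable {E : Type*} [NormedAddCommGroup E] [NormedSpace ℂ E] {U : Opens E}

/-- The linear space of all holomorphic `f : U → F` with `sup_{x ∈ U} v x * ‖f x‖ < ∞`. -/
def weightedHolSubmodule (v : Weight U) (F : Type*) [NormedAddCommGroup F] [NormedSpace ℂ F] :
    Submodule ℂ (U → F) where
  carrier := {f | IsHolomorphic f ∧ BddAbove (Set.range fun x : U => v.toFun x * ‖f x‖)}
  zero_mem' := ⟨⟨0, differentiableOn_const 0, fun _ => rfl⟩, 0, by rintro _ ⟨x, rfl⟩; simp⟩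
  add_mem' := by
    rintro f g ⟨⟨f', hf, hf'⟩, A, hA⟩ ⟨⟨g', hg, hg'⟩, B, hB⟩
    refine ⟨⟨f' + g', hf.add hg, fun x => by simp [hf', hg']⟩, A + B, ?_⟩
    rintro _ ⟨x, rfl⟩
    have h1 : v.toFun x * ‖f x‖ ≤ A := hA ⟨x, rfl⟩
    have h2 : v.toFun x * ‖g x‖ ≤ B := hB ⟨x, rfl⟩
    have h3 := mul_le_mul_of_nonneg_left (norm_add_le (f x) (g x)) (v.pos x).le
    simp only [Pi.add_apply]
    linarith
  smul_mem' := by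
    rintro c f ⟨⟨f', hf, hf'⟩, A, hA⟩
    refine ⟨⟨c • f', hf.const_smul c, fun x => by simp [hf']⟩, ‖c‖ * A, ?_⟩
    rintro _ ⟨x, rfl⟩
    have h1 : v.toFun x * ‖f x‖ ≤ A := hA ⟨x, rfl⟩
    have h2 := mul_le_mul_of_nonneg_left h1 (norm_nonneg c)
    simp only [Pi.smul_apply, norm_smul]
    linarith

/-- The space of weighted holomorphic maps `U → F`. It is a type of its own, so that its only
topology is the one of the weighted supremum norm. -/
def WeightedHol (v : Weight U) (F : Type*) [NormedAddCommGroup F] [NormedSpace ℂ F] : Type _ :=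
  ↥(weightedHolSubmodule v F)

namespace WeightedHol

variable {v : Weight U} {F : Type*} [NormedAddCommGroup F] [NormedSpace ℂ F]

/-- The underlying map `U → F`. -/
def toFun (f : WeightedHol v F) : U → F := Subtype.val f

theorem ext_toFun {f g : WeightedHol v F} (h : f.toFun = g.toFun) : f = g := Subtype.ext h

theorem bddAbove (f : WeightedHol v F) :
    BddAbove (Set.range fun x : U => v.toFun x * ‖f.toFun x‖) :=
  (Subtype.property f).2

noncomputable instance : AddCommGroup (WeightedHol v F) :=
  inferInstanceAs (AddCommGroup ↥(weightedHolSubmodule v F))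

noncomputable instance : Module ℂ (WeightedHol v F) :=
  inferInstanceAs (Module ℂ ↥(weightedHolSubmodule v F))

/-- The weighted supremum norm. -/
noncomputable instance : Norm (WeightedHol v F) :=
  ⟨fun f => ⨆ x : U, v.toFun x * ‖f.toFun x‖⟩

theorem norm_def (f : WeightedHol v F) : ‖f‖ = ⨆ x : U, v.toFun x * ‖f.toFun x‖ := rfl

theorem toFun_zero : (0 : WeightedHol v F).toFun = 0 := rfl

theorem toFun_add (f g : WeightedHol v F) : (f + g).toFun = f.toFun + g.toFun := rfl

theorem toFun_smul (c : ℂ) (f : WeightedHol v F) : (c • f).toFun = c • f.toFun := rfl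

theorem le_norm (f : WeightedHol v F) (x : U) : v.toFun x * ‖f.toFun x‖ ≤ ‖f‖ :=
  le_ciSup f.bddAbove x

theorem norm_nonneg' (f : WeightedHol v F) : 0 ≤ ‖f‖ :=
  Real.iSup_nonneg fun x => mul_nonneg (v.pos x).le (norm_nonneg _)

theorem normCore : NormedSpace.Core ℂ (WeightedHol v F) where
  norm_nonneg := norm_nonneg'
  norm_smul c f := by
    rw [norm_def, norm_def, Real.mul_iSup_of_nonneg (norm_nonneg c)]
    refine iSup_congr fun x => ?_
    rw [toFun_smul, Pi.smul_apply, norm_smul]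
    ring
  norm_triangle f g := by
    refine Real.iSup_le (fun x => ?_) (add_nonneg (norm_nonneg' f) (norm_nonneg' g))
    have h1 := le_norm f x
    have h2 := le_norm g x
    have h3 := mul_le_mul_of_nonneg_left (norm_add_le (f.toFun x) (g.toFun x)) (v.pos x).le
    rw [toFun_add, Pi.add_apply]
    linarith
  norm_eq_zero_iff f := by
    constructor
    · intro h
      refine ext_toFun (funext fun x => ?_)
      have h1 := le_norm f x
      rw [h] at h1
      have h2 : ‖f.toFun x‖ ≤ 0 := nonpos_of_mul_nonpos_right h1 (v.pos x)
      simpa [toFun_zero] using h2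
    · rintro rfl
      simp [norm_def, toFun_zero]

noncomputable instance : NormedAddCommGroup (WeightedHol v F) :=
  NormedAddCommGroup.ofCore normCore

noncomputable instance : NormedSpace ℂ (WeightedHol v F) :=
  NormedSpace.ofCore normCore

end WeightedHol

/-- The `v`-range `{v x • f x | x ∈ U}` of `f : U → F`. -/
def vRange (v : Weight U) {F : Type*} [NormedAddCommGroup F] [NormedSpace ℂ F] (f : U → F) :
    Set F :=
  Set.range fun x : U => (v.toFun x : ℂ) • f x

/-- The holomorphic maps `U → F` with relatively compact `v`-range. -/
def weightedHolCompact (v : Weight U) (F : Type*) [NormedAddCommGroup F] [NormedSpace ℂ F] :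
    Set (U → F) :=
  {f | IsHolomorphic f ∧ IsCompact (closure (vRange v f))}

/-- The weighted holomorphic maps of finite-dimensional `v`-rank. -/
def weightedHolFiniteRank (v : Weight U) (F : Type*) [NormedAddCommGroup F] [NormedSpace ℂ F] :
    Set (WeightedHol v F) :=
  {f | FiniteDimensional ℂ (Submodule.span ℂ (vRange v f.toFun))}

/-- The approximable weighted holomorphic maps: limits in the weighted supremum norm of sequences
of weighted holomorphic maps of finite-dimensional `v`-rank. -/
def weightedHolApproximable (v : Weight U) (F : Type*) [NormedAddCommGroup F] [NormedSpace ℂ F] :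
    Set (U → F) :=
  {f | ∃ f' : WeightedHol v F, f'.toFun = f ∧
    ∃ g : ℕ → WeightedHol v F, (∀ n, g n ∈ weightedHolFiniteRank v F) ∧
      Tendsto (fun n => ‖g n - f'‖) atTop (𝓝 0)}

end Space

/-- The approximation property: on each compact set the identity is uniformly approximated by
bounded linear operators of finite rank. -/
def HasApproximationProperty (X : Type*) [NormedAddCommGroup X] [NormedSpace ℂ X] : Prop :=
  ∀ K : Set X, IsCompact K → ∀ ε : ℝ, 0 < ε →
    ∃ T : X →L[ℂ] X, FiniteDimensional ℂ (LinearMap.range (T : X →ₗ[ℂ] X)) ∧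
      ∀ x ∈ K, ‖T x - x‖ < ε

/-! Write H for `WeightedHol v ℂ` and δ_x for evaluation at x. The map x ↦ δ_x is holomorphic into
the dual H', the functionals v(x)δ_x lie in its unit ball, and combinations of the δ_x approximate
every element of H' uniformly on compact sets (`exists_mem_span_eval_near_of_isCompact`).

If H has the approximation property and f has relatively compact v-range, then {φ ∘ f : ‖φ‖ ≤ 1} is
compact in H, so some T = ∑ μ_i ⊗ h_i is close to the identity there. Replacing each μ_i by a
combination of evaluations, which acts on φ ∘ f as φ(y_i) for some y_i ∈ F, shows by duality that ∑
h_i ⊗ y_i is close to f.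

Conversely, let (p_n) be dense in a compact K ⊆ H and let R : H' → ℓ^∞ be L ↦ (L p_n). Then x ↦ R
δ_x has relatively compact v-range and n-th coordinate p_n. Approximate it by ∑ h_i ⊗ y_i and y_i by
R L_i; then ∑ L_i ⊗ h_i is close to the identity at all p_n. -/

open scoped BoundedContinuousFunction

/-! ### Compactness and finite rank in normed spaces -/

/-- A finite-dimensional subspace has finitely many vectors and globally defined continuous
functionals which expand each of its elements. -/
theorem exists_finite_expansion {X : Type*} [NormedAddCommGroup X] [NormedSpace ℂ X]
    (W : Submodule ℂ X) [FiniteDimensional ℂ W] :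
    ∃ (n : ℕ) (y : Fin n → X) (c : Fin n → X →L[ℂ] ℂ), (∀ i, y i ∈ W) ∧
      ∀ w ∈ W, ∑ i, c i w • y i = w := by
  obtain ⟨p, hp⟩ : ∃ p : X →L[ℂ] W, ∀ x : W, p x = x :=
    Submodule.ClosedComplemented.of_finiteDimensional W
  let b := Module.finBasis ℂ W
  refine ⟨_, fun i => b i, fun i => (b.coord i).toContinuousLinearMap.comp p,
    fun i => (b i).2, fun w hw => ?_⟩
  have hpw : p w = ⟨w, hw⟩ := hp ⟨w, hw⟩
  have h := congrArg W.subtype (b.sum_repr (p w))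
  rw [map_sum] at h
  exact h.trans (congrArg W.subtype hpw)

/-- The image of the dual unit ball under a map that is controlled by the uniform distance on a
compact set is compact. -/
theorem isCompact_image_dual_closedBall {X Y : Type*} [NormedAddCommGroup X] [NormedSpace ℂ X]
    [PseudoMetricSpace Y] {K : Set X} (hK : IsCompact K) (R : StrongDual ℂ X → Y)
    (hR : ∀ (φ ψ : StrongDual ℂ X) (ε : ℝ), 0 ≤ ε → (∀ k ∈ K, ‖φ k - ψ k‖ ≤ ε) →
      dist (R φ) (R ψ) ≤ ε) :
    IsCompact (R '' Metric.closedBall 0 1) := by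
  -- By Banach–Alaoglu it is enough that `R` be weak-* continuous on the ball.
  have hball := WeakDual.isCompact_closedBall (𝕜 := ℂ) (0 : StrongDual ℂ X) 1
  have hcont : ContinuousOn (fun φ : WeakDual ℂ X => R (WeakDual.toStrongDual φ))
      (WeakDual.toStrongDual ⁻¹' Metric.closedBall (0 : StrongDual ℂ X) 1) := by
    intro φ hφ
    rw [ContinuousWithinAt, Metric.tendsto_nhds]
    intro ε hε
    -- Functionals in the ball are 1-Lipschitz, so closeness on a finite net of `K` spreads to all
    -- of `K`.
    obtain ⟨t, -, ht, hcover⟩ := hK.finite_cover_balls (e := ε / 4) (by linarith)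
    have hev : ∀ᶠ ψ in 𝓝 φ, ∀ a ∈ t, ‖ψ a - φ a‖ < ε / 4 := by
      rw [eventually_all_finite ht]
      intro a _
      have := (WeakDual.eval_continuous (𝕜 := ℂ) a).tendsto φ
      simpa [dist_eq_norm] using Metric.tendsto_nhds.1 this (ε / 4) (by linarith)
    filter_upwards [nhdsWithin_le_nhds hev, self_mem_nhdsWithin] with ψ hψ hψ1
    refine (hR _ _ (3 * (ε / 4)) (by linarith) fun k hk => ?_).trans_lt (by linarith)
    obtain ⟨a, ha, hka⟩ := Set.mem_iUnion₂.1 (hcover hk)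
    have key : ∀ χ : StrongDual ℂ X, χ ∈ Metric.closedBall (0 : StrongDual ℂ X) 1 →
        ‖χ k - χ a‖ ≤ ε / 4 := by
      intro χ hχ
      rw [mem_closedBall_zero_iff] at hχ
      rw [← map_sub]
      rw [Metric.mem_ball, dist_eq_norm] at hka
      calc ‖χ (k - a)‖ ≤ 1 * ‖k - a‖ := χ.le_of_opNorm_le hχ _
        _ ≤ ε / 4 := by linarith
    have h1 := key _ hψ1
    have h2 := key _ hφ
    have h3 : ‖WeakDual.toStrongDual ψ a - WeakDual.toStrongDual φ a‖ < ε / 4 := hψ a ha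
    calc ‖WeakDual.toStrongDual ψ k - WeakDual.toStrongDual φ k‖
        = ‖(WeakDual.toStrongDual ψ k - WeakDual.toStrongDual ψ a)
          + (WeakDual.toStrongDual ψ a - WeakDual.toStrongDual φ a)
          - (WeakDual.toStrongDual φ k - WeakDual.toStrongDual φ a)‖ := by congr 1; ring
      _ ≤ _ := norm_sub_le_of_le (norm_add_le_of_le h1 h3.le) h2
      _ = 3 * (ε / 4) := by ring
  have himage := hball.image_of_continuousOn hcont
  rwa [show (fun φ : WeakDual ℂ X => R (WeakDual.toStrongDual φ)) =
    R ∘ WeakDual.toStrongDual from rfl, Set.image_comp,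
    Set.image_preimage_eq _ WeakDual.toStrongDual.surjective] at himage

/-- Testing along a sequence lets the converse use a target space inside ℓ^∞ over a countable index
set. -/
theorem IsCompact.exists_dense_range {X : Type*} [PseudoMetricSpace X] {K : Set X}
    (hK : IsCompact K) (hne : K.Nonempty) :
    ∃ p : ℕ → X, (∀ n, p n ∈ K) ∧ K ⊆ closure (Set.range p) := by
  have : Nonempty K := hne.to_subtype
  have : CompactSpace K := isCompact_iff_compactSpace.1 hK
  obtain ⟨q, hq⟩ := exists_dense_seq K
  refine ⟨fun n => q n, fun n => (q n).2, fun k hk => ?_⟩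
  have h := image_closure_subset_closure_image continuous_subtype_val
    (Set.mem_image_of_mem Subtype.val (hq ⟨k, hk⟩))
  rwa [← Set.range_comp] at h

theorem norm_apply_sub_le_of_mem_closure {X : Type*} [NormedAddCommGroup X] [NormedSpace ℂ X]
    {T : X →L[ℂ] X} {p : ℕ → X} {ε : ℝ} (h : ∀ n, ‖T (p n) - p n‖ ≤ ε) {x : X}
    (hx : x ∈ closure (Set.range p)) : ‖T x - x‖ ≤ ε :=
  closure_minimal (Set.range_subset_iff.2 h)
    (isClosed_le (T.continuous.sub continuous_id).norm continuous_const) hx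

/-! ### Cauchy and Schwarz estimates -/

/-- The quadratic Taylor remainder of a bounded holomorphic function on a ball, together with
Cauchy's estimate for the derivative at the centre. -/
theorem norm_fderiv_le_and_norm_taylor_le {E : Type*} [NormedAddCommGroup E] [NormedSpace ℂ E]
    {h : E → ℂ} {x : E} {r M : ℝ} (hr : 0 < r) (hd : DifferentiableOn ℂ h (Metric.ball x r))
    (hM : ∀ y ∈ Metric.ball x r, ‖h y‖ ≤ M) :
    ‖fderiv ℂ h x‖ ≤ 2 * M / r ∧ ∀ y ∈ Metric.ball x r,
      ‖h y - h x - fderiv ℂ h x (y - x)‖ ≤ 4 * M * (‖y - x‖ / r) ^ 2 := by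
  have hx : x ∈ Metric.ball x r := Metric.mem_ball_self hr
  have hM2 : ∀ y ∈ Metric.ball x r, ‖h y - h x‖ ≤ 2 * M := fun y hy =>
    (norm_sub_le_of_le (hM y hy) (hM x hx)).trans_eq (by ring)
  have h1 : ‖fderiv ℂ h x‖ ≤ 2 * M / r := by
    refine Complex.norm_fderiv_le_div_of_mapsTo_ball hd (fun y hy => ?_) hr
    simpa [dist_eq_norm] using hM2 y hy
  refine ⟨h1, fun y hy => ?_⟩
  have hat : HasFDerivAt h (fderiv ℂ h x) x :=
    (hd.differentiableAt (Metric.ball_mem_nhds x hr)).hasFDerivAt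
  -- Higher-order Schwarz lemma: the remainder is o(‖y - x‖) and bounded by 4M, hence quadratically
  -- small.
  have := Complex.dist_le_mul_div_pow_of_mapsTo_ball_of_isLittleO (n := 1) (R₂ := 4 * M)
    (f := fun y => h y - h x - fderiv ℂ h x (y - x)) (c := x) (R₁ := r) (z := y)
    ((hd.sub_const _).sub (by fun_prop)) (fun z hz => ?_) ?_ hy
  · simpa [dist_eq_norm] using this
  · have h2 : ‖fderiv ℂ h x (z - x)‖ ≤ 2 * M := by
      have hz' : ‖z - x‖ ≤ r := by simpa [dist_eq_norm] using (Metric.mem_ball.1 hz).le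
      calc ‖fderiv ℂ h x (z - x)‖ ≤ 2 * M / r * r :=
            ContinuousLinearMap.le_of_opNorm_le_of_le _ h1 hz'
        _ = 2 * M := by field_simp
    simpa [dist_eq_norm] using
      (norm_sub_le_of_le (hM2 z hz) h2).trans_eq (by ring : 2 * M + 2 * M = 4 * M)
  · simpa using hat.isLittleO.norm_right

/-! ### Composition with linear maps -/

namespace WeightedHol

variable {E : Type*} [NormedAddCommGroup E] [NormedSpace ℂ E] {U : Opens E} {v : Weight U}
  {F : Type*} [NormedAddCommGroup F] [NormedSpace ℂ F]
  {G : Type*} [NormedAddCommGroup G] [NormedSpace ℂ G]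

theorem norm_le {f : WeightedHol v F} {C : ℝ} (hC : 0 ≤ C)
    (h : ∀ x, v.toFun x * ‖f.toFun x‖ ≤ C) : ‖f‖ ≤ C :=
  Real.iSup_le h hC

/-- A holomorphic map with relatively compact `v`-range is a weighted holomorphic map. -/
theorem exists_toFun_eq_of_mem_compact {f : U → F} (hf : f ∈ weightedHolCompact v F) :
    ∃ f' : WeightedHol v F, f'.toFun = f := by
  refine ⟨⟨f, hf.1, ?_⟩, rfl⟩
  obtain ⟨C, hC⟩ := hf.2.isBounded.exists_norm_le
  refine ⟨C, ?_⟩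
  rintro _ ⟨x, rfl⟩
  have := hC _ (subset_closure ⟨x, rfl⟩)
  simpa [norm_smul, abs_of_pos (v.pos x)] using this

/-- Composition with a continuous linear map. -/
noncomputable def comp (φ : F →L[ℂ] G) : WeightedHol v F →ₗ[ℂ] WeightedHol v G where
  toFun f := ⟨fun x => φ (f.toFun x), by
    obtain ⟨⟨g, hg, hgf⟩, A, hA⟩ := Subtype.property f
    refine ⟨⟨fun y => φ (g y), φ.differentiable.comp_differentiableOn hg,
      fun x => congrArg φ (hgf x)⟩, ‖φ‖ * A, ?_⟩
    rintro _ ⟨x, rfl⟩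
    have h1 : v.toFun x * ‖f.toFun x‖ ≤ A := hA ⟨x, rfl⟩
    calc v.toFun x * ‖φ (f.toFun x)‖ ≤ v.toFun x * (‖φ‖ * ‖f.toFun x‖) :=
          mul_le_mul_of_nonneg_left (φ.le_opNorm _) (v.pos x).le
      _ = ‖φ‖ * (v.toFun x * ‖f.toFun x‖) := by ring
      _ ≤ ‖φ‖ * A := mul_le_mul_of_nonneg_left h1 (norm_nonneg _)⟩
  map_add' f g := ext_toFun (funext fun x => map_add φ (f.toFun x) (g.toFun x))
  map_smul' c f := ext_toFun (funext fun x => map_smul φ c (f.toFun x))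

theorem comp_toFun (φ : F →L[ℂ] G) (f : WeightedHol v F) (x : U) :
    (comp φ f).toFun x = φ (f.toFun x) := rfl

theorem norm_comp_le {φ : F →L[ℂ] G} (hφ : ‖φ‖ ≤ 1) (f : WeightedHol v F) :
    ‖comp φ f‖ ≤ ‖f‖ := by
  refine norm_le (norm_nonneg _) fun x => le_trans ?_ (le_norm f x)
  refine mul_le_mul_of_nonneg_left ?_ (v.pos x).le
  exact (φ.le_of_opNorm_le hφ (f.toFun x)).trans_eq (one_mul _)

theorem norm_le_of_forall_norm_comp_le {f : WeightedHol v F} {C : ℝ} (hC : 0 ≤ C)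
    (h : ∀ φ : StrongDual ℂ F, ‖φ‖ ≤ 1 → ‖comp φ f‖ ≤ C) : ‖f‖ ≤ C := by
  refine norm_le hC fun x => ?_
  obtain ⟨φ, hφ, hφx⟩ := exists_dual_vector'' ℂ (f.toFun x)
  have := (le_norm (comp φ f) x).trans (h φ hφ)
  rw [comp_toFun, hφx] at this
  simpa using this

/-! ### Evaluation functionals and their holomorphy -/

/-- Evaluation at a point, as a continuous linear map. -/
noncomputable def eval (v : Weight U) (x : U) : WeightedHol v ℂ →L[ℂ] ℂ :=
  LinearMap.mkContinuous
    { toFun := fun f => f.toFun x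
      map_add' := fun _ _ => rfl
      map_smul' := fun _ _ => rfl } (v.toFun x)⁻¹ fun f => by
    have := le_norm f x
    rw [inv_mul_eq_div, le_div_iff₀ (v.pos x), mul_comm]
    exact this

theorem eval_apply (x : U) (f : WeightedHol v ℂ) : eval v x f = f.toFun x := rfl

theorem norm_smul_eval_le (x : U) : ‖(v.toFun x : ℂ) • eval v x‖ ≤ 1 := by
  refine ContinuousLinearMap.opNorm_le_bound _ zero_le_one fun f => ?_
  have := le_norm f x
  simpa [norm_smul, abs_of_pos (v.pos x), eval_apply] using this

open Classical in
/-- Evaluation at a point of `E`, extended by zero outside of `U`. -/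
noncomputable def evalExt (v : Weight U) (y : E) : WeightedHol v ℂ →L[ℂ] ℂ :=
  if hy : y ∈ U then eval v ⟨y, hy⟩ else 0

theorem evalExt_coe (x : U) : evalExt v (x : E) = eval v x := dif_pos x.2

theorem differentiableOn_evalExt_apply (h : WeightedHol v ℂ) :
    DifferentiableOn ℂ (fun y => evalExt v y h) (U : Set E) := by
  obtain ⟨⟨g, hg, hgh⟩, -⟩ := Subtype.property h
  refine hg.congr fun y hy => ?_
  rw [show evalExt v y = eval v ⟨y, hy⟩ from dif_pos hy, eval_apply]
  exact (hgh ⟨y, hy⟩).symm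

/-- Continuity of `v` keeps it above v(x)/2 near x. -/
theorem exists_ball_norm_evalExt_le (x : U) : ∃ r > 0, ∃ C, 0 ≤ C ∧
    Metric.ball (x : E) r ⊆ U ∧
    ∀ y ∈ Metric.ball (x : E) r, ∀ h : WeightedHol v ℂ, ‖evalExt v y h‖ ≤ C * ‖h‖ := by
  have hpos := v.pos x
  have hev : ∀ᶠ z in 𝓝 x, v.toFun x / 2 < v.toFun z :=
    v.continuous_toFun.continuousAt.eventually (lt_mem_nhds (by linarith))
  have hev' : ∀ᶠ y in 𝓝 (x : E), ∀ hy : y ∈ U, v.toFun x / 2 < v.toFun ⟨y, hy⟩ := by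
    rw [nhds_subtype_eq_comap, eventually_comap] at hev
    filter_upwards [hev] with y hy hyU using hy ⟨y, hyU⟩ rfl
  obtain ⟨r, hr, hball⟩ := Metric.eventually_nhds_iff_ball.1 (hev'.and (U.isOpen.mem_nhds x.2))
  refine ⟨r, hr, 2 / v.toFun x, by positivity, fun y hy => (hball y hy).2, fun y hy h => ?_⟩
  have hyU : y ∈ U := (hball y hy).2
  have h1 := (hball y hy).1 hyU
  rw [show evalExt v y = eval v ⟨y, hyU⟩ from dif_pos hyU, eval_apply, div_mul_eq_mul_div,
    le_div_iff₀ hpos]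
  have h2 := le_norm h ⟨y, hyU⟩
  have h3 := mul_le_mul_of_nonneg_right h1.le (norm_nonneg (h.toFun ⟨y, hyU⟩))
  linarith

/-- The evaluation map `U → (WeightedHol v ℂ)'` is holomorphic. -/
theorem differentiableOn_evalExt : DifferentiableOn ℂ (evalExt v) (U : Set E) := by
  intro x hx
  obtain ⟨r, hr, C, hC, hrU, hbd⟩ := exists_ball_norm_evalExt_le (v := v) ⟨x, hx⟩
  have hd : ∀ h : WeightedHol v ℂ, DifferentiableOn ℂ (fun y => evalExt v y h)
      (Metric.ball x r) := fun h => (differentiableOn_evalExt_apply h).mono hrU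
  have hat : ∀ h : WeightedHol v ℂ, DifferentiableAt ℂ (fun y => evalExt v y h) x :=
    fun h => (hd h).differentiableAt (Metric.ball_mem_nhds x hr)
  have hT := fun h : WeightedHol v ℂ =>
    norm_fderiv_le_and_norm_taylor_le hr (hd h) fun y hy => hbd y hy h
  -- The flip of `B` is the candidate derivative; the Taylor bound is uniform over the unit ball in
  -- `h`, which gives differentiability in operator norm.
  let B : WeightedHol v ℂ →L[ℂ] E →L[ℂ] ℂ := LinearMap.mkContinuous
    { toFun := fun h => fderiv ℂ (fun y => evalExt v y h) x
      map_add' := fun h k => by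
        simp only [map_add]
        exact fderiv_fun_add (hat h) (hat k)
      map_smul' := fun c h => by
        simp only [map_smul, RingHom.id_apply]
        exact fderiv_fun_const_smul (hat h) c } (2 * C / r) fun h =>
          (hT h).1.trans_eq (by ring)
  refine HasFDerivAt.differentiableAt (f' := B.flip) ?_ |>.differentiableWithinAt
  rw [hasFDerivAt_iff_isLittleO]
  refine Asymptotics.IsBigO.trans_isLittleO (g := fun y => ‖y - x‖ ^ 2) ?_
    (Asymptotics.isLittleO_pow_sub_sub x one_lt_two)
  refine Asymptotics.IsBigO.of_bound (4 * C / r ^ 2) ?_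
  filter_upwards [Metric.ball_mem_nhds x hr] with y hy
  refine ContinuousLinearMap.opNorm_le_bound _ (by positivity) fun h => ?_
  refine ((hT h).2 y hy).trans_eq ?_
  rw [norm_pow, norm_norm, div_pow]
  ring

/-! ### Approximating functionals by evaluations -/

/-- On finitely many functions, a continuous functional is approximated by a combination of
evaluations whose norm does not exceed that of the functional. -/
theorem exists_mem_span_eval_near {n : ℕ} (h : Fin n → WeightedHol v ℂ)
    (μ : WeightedHol v ℂ →L[ℂ] ℂ) {δ : ℝ} (hδ : 0 < δ) :
    ∃ L ∈ Submodule.span ℂ (Set.range (eval v)), ‖L‖ ≤ ‖μ‖ ∧ ∀ i, ‖μ (h i) - L (h i)‖ < δ := by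
  let S : Set (WeightedHol v ℂ →L[ℂ] ℂ) :=
    (Submodule.span ℂ (Set.range (eval v)) : Set _) ∩ Metric.closedBall 0 ‖μ‖
  let P : (WeightedHol v ℂ →L[ℂ] ℂ) →ₗ[ℂ] (Fin n → ℂ) :=
    LinearMap.pi fun i => (ContinuousLinearMap.apply ℂ ℂ (h i)).toLinearMap
  have hS : Convex ℝ S :=
    ((Submodule.span ℂ (Set.range (eval v))).restrictScalars ℝ).convex.inter
      (convex_closedBall _ _)
  have hPS : Convex ℝ (P '' S) := hS.linear_image (P.restrictScalars ℝ)
  suffices hmem : P μ ∈ closure (P '' S) by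
    obtain ⟨_, ⟨L, hL, rfl⟩, hLμ⟩ := Metric.mem_closure_iff.1 hmem δ hδ
    refine ⟨L, hL.1, by simpa using hL.2, fun i => ?_⟩
    rw [dist_pi_lt_iff hδ] at hLμ
    simpa [dist_eq_norm, P] using hLμ i
  -- Otherwise Hahn–Banach separates `P μ` from `P '' S` in ℂⁿ, and the separating functional
  -- composed with `P` is evaluation at one element `k`.
  by_contra hnot
  obtain ⟨f, u, hfu, huf⟩ := RCLike.geometric_hahn_banach_closed_point (𝕜 := ℂ) hPS.closure
    isClosed_closure hnot
  let k : WeightedHol v ℂ := ∑ i, f (Pi.single i 1) • h i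
  have hf : ∀ L : WeightedHol v ℂ →L[ℂ] ℂ, f (P L) = L k := by
    intro L
    have : P L = ∑ i, L (h i) • (Pi.single i 1 : Fin n → ℂ) := by
      ext j
      simp [P, Pi.single_apply]
    rw [this]
    simp [k, mul_comm]
  have hbound : ∀ L ∈ S, (L k).re ≤ u := fun L hL => by
    rw [← hf]
    exact (hfu _ (subset_closure ⟨L, hL, rfl⟩)).le
  have hu : 0 ≤ u := by
    simpa using hbound 0 ⟨zero_mem _, by simp⟩
  have hx : ∀ x : U, ‖μ‖ * (v.toFun x * ‖k.toFun x‖) ≤ u := by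
    intro x
    obtain ⟨c, hc, hck⟩ : ∃ c : ℂ, ‖c‖ ≤ 1 ∧ c * k.toFun x = ‖k.toFun x‖ := by
      obtain ⟨c, hc, hck⟩ := exists_dual_vector'' ℂ (k.toFun x)
      refine ⟨c 1, by simpa using c.le_of_opNorm_le hc 1, ?_⟩
      have h1 := c.map_smul (k.toFun x) 1
      simp only [smul_eq_mul, mul_one] at h1
      rw [mul_comm, ← h1, hck]
      rfl
    -- A multiple of v(x)δ_x of norm at most ‖μ‖, rotated so that its value at `k` is real and
    -- nonnegative.
    have h1 := hbound (((‖μ‖ : ℂ) * c) • ((v.toFun x : ℂ) • eval v x)) ⟨?_, ?_⟩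
    · have h2 : (((‖μ‖ : ℂ) * c) • ((v.toFun x : ℂ) • eval v x)) k
          = ((‖μ‖ * (v.toFun x * ‖k.toFun x‖) : ℝ) : ℂ) := by
        push_cast
        rw [← hck]
        change ‖μ‖ * c * (v.toFun x * k.toFun x) = ‖μ‖ * (v.toFun x * (c * k.toFun x))
        ring
      rwa [h2, Complex.ofReal_re] at h1
    · exact Submodule.smul_mem _ _ (Submodule.smul_mem _ _ (Submodule.subset_span ⟨x, rfl⟩))
    · rw [mem_closedBall_zero_iff, norm_smul, norm_mul, Complex.norm_real, norm_norm]
      calc ‖μ‖ * ‖c‖ * ‖(v.toFun x : ℂ) • eval v x‖ ≤ ‖μ‖ * 1 * 1 := by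
            gcongr
            exact norm_smul_eval_le x
        _ = ‖μ‖ := by ring
  have hk : ‖μ‖ * ‖k‖ ≤ u := by
    rw [norm_def, Real.mul_iSup_of_nonneg (norm_nonneg _)]
    -- `hu` covers the case of empty `U`.
    exact Real.iSup_le hx hu
  rw [hf] at huf
  have h1 : (μ k).re ≤ ‖μ‖ * ‖k‖ := (Complex.re_le_norm _).trans (μ.le_opNorm k)
  exact absurd huf (not_lt.2 (h1.trans hk))

/-- On a compact set, a continuous functional is approximated by a combination of evaluations. -/
theorem exists_mem_span_eval_near_of_isCompact {K : Set (WeightedHol v ℂ)} (hK : IsCompact K)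
    (μ : WeightedHol v ℂ →L[ℂ] ℂ) {δ : ℝ} (hδ : 0 < δ) :
    ∃ L ∈ Submodule.span ℂ (Set.range (eval v)), ∀ k ∈ K, ‖μ k - L k‖ ≤ δ := by
  -- Chosen so that functionals of norm at most ‖μ‖ vary by at most δ/3 on each ball; the +1 allows
  -- μ = 0.
  have hη : 0 < δ / (3 * (‖μ‖ + 1)) := by positivity
  obtain ⟨t, -, ht, hcover⟩ := hK.finite_cover_balls hη
  obtain ⟨n, h, -, hh⟩ := ht.fin_param
  obtain ⟨L, hL, hLμ, hLh⟩ := exists_mem_span_eval_near h μ (δ := δ / 3) (by positivity)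
  refine ⟨L, hL, fun k hk => ?_⟩
  obtain ⟨a, ha, hka⟩ := Set.mem_iUnion₂.1 (hcover hk)
  obtain ⟨i, rfl⟩ : a ∈ Set.range h := hh ▸ ha
  rw [Metric.mem_ball, dist_eq_norm] at hka
  have key : ∀ χ : WeightedHol v ℂ →L[ℂ] ℂ, ‖χ‖ ≤ ‖μ‖ → ‖χ k - χ (h i)‖ ≤ δ / 3 := by
    intro χ hχ
    rw [← map_sub]
    calc ‖χ (k - h i)‖ ≤ (‖μ‖ + 1) * (δ / (3 * (‖μ‖ + 1))) :=
          ContinuousLinearMap.le_of_opNorm_le_of_le _ (by linarith) hka.le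
      _ = δ / 3 := by field_simp
  calc ‖μ k - L k‖ = ‖(μ k - μ (h i)) + (μ (h i) - L (h i)) - (L k - L (h i))‖ := by
        congr 1; ring
    _ ≤ δ / 3 + δ / 3 + δ / 3 :=
        norm_sub_le_of_le (norm_add_le_of_le (key μ le_rfl) (hLh i).le) (key L hLμ)
    _ = δ := by ring

/-- Combinations of evaluations act on the compositions `φ ∘ f` through a vector of `F`. -/
theorem exists_apply_comp_eq (f : WeightedHol v F) {L : WeightedHol v ℂ →L[ℂ] ℂ}
    (hL : L ∈ Submodule.span ℂ (Set.range (eval v))) :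
    ∃ y : F, ∀ φ : StrongDual ℂ F, L (comp φ f) = φ y := by
  induction hL using Submodule.span_induction with
  | mem L hL =>
    obtain ⟨x, rfl⟩ := hL
    exact ⟨f.toFun x, fun φ => rfl⟩
  | zero => exact ⟨0, fun φ => by simp⟩
  | add L M _ _ hL hM =>
    obtain ⟨y, hy⟩ := hL
    obtain ⟨z, hz⟩ := hM
    exact ⟨y + z, fun φ => by simp [hy, hz]⟩
  | smul c L _ hL =>
    obtain ⟨y, hy⟩ := hL
    exact ⟨c • y, fun φ => by simp [hy]⟩

/-- The weighted distance between φ ∘ f and ψ ∘ f is the supremum of |φ - ψ| over the v-range. -/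
theorem isCompact_image_comp (f : WeightedHol v F) (hf : IsCompact (closure (vRange v f.toFun))) :
    IsCompact ((fun φ : StrongDual ℂ F => comp φ f) '' Metric.closedBall 0 1) := by
  refine isCompact_image_dual_closedBall hf _ fun φ ψ ε hε h => ?_
  rw [dist_eq_norm]
  refine norm_le hε fun x => ?_
  have h1 := h _ (subset_closure ⟨x, rfl⟩)
  have h2 : (comp φ f - comp ψ f).toFun x = φ (f.toFun x) - ψ (f.toFun x) := rfl
  rw [h2]
  simpa [← mul_sub, abs_of_pos (v.pos x)] using h1

/-! ### Finite-rank maps as sums of tensors -/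

/-- The elementary tensor `x ↦ h x • y`. -/
noncomputable def tensor (h : WeightedHol v ℂ) (y : F) : WeightedHol v F :=
  comp (ContinuousLinearMap.toSpanSingleton ℂ y) h

theorem tensor_toFun (h : WeightedHol v ℂ) (y : F) (x : U) :
    (tensor h y).toFun x = h.toFun x • y := rfl

theorem toFun_sum {ι : Type*} (s : Finset ι) (g : ι → WeightedHol v F) (x : U) :
    (∑ i ∈ s, g i).toFun x = ∑ i ∈ s, (g i).toFun x := by
  classical
  induction s using Finset.induction_on with
  | empty => rfl
  | insert a s ha ih =>
    rw [Finset.sum_insert ha, Finset.sum_insert ha, toFun_add, Pi.add_apply, ih]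

theorem comp_tensor (φ : F →L[ℂ] ℂ) (h : WeightedHol v ℂ) (y : F) :
    comp φ (tensor h y) = φ y • h := by
  refine ext_toFun (funext fun x => ?_)
  rw [comp_toFun, tensor_toFun, map_smul, toFun_smul, Pi.smul_apply, smul_eq_mul, smul_eq_mul,
    mul_comm]

theorem sum_tensor_mem_finiteRank {n : ℕ} (h : Fin n → WeightedHol v ℂ) (y : Fin n → F) :
    ∑ i, tensor (h i) (y i) ∈ weightedHolFiniteRank v F := by
  have hle : Submodule.span ℂ (vRange v (∑ i, tensor (h i) (y i)).toFun)
      ≤ Submodule.span ℂ (Set.range y) := by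
    rw [Submodule.span_le]
    rintro _ ⟨x, rfl⟩
    simp only [toFun_sum, tensor_toFun]
    exact Submodule.smul_mem _ _ (Submodule.sum_mem _ fun i _ =>
      Submodule.smul_mem _ _ (Submodule.subset_span ⟨i, rfl⟩))
  have : FiniteDimensional ℂ (Submodule.span ℂ (Set.range y)) :=
    FiniteDimensional.span_of_finite ℂ (Set.finite_range y)
  exact Submodule.finiteDimensional_of_le hle

/-- Since v(x) ≠ 0, g(x) itself lies in the span of the v-range; globally defined coordinate
functionals make the coefficients weighted holomorphic. -/
theorem exists_eq_sum_tensor {g : WeightedHol v F} (hg : g ∈ weightedHolFiniteRank v F) :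
    ∃ (n : ℕ) (h : Fin n → WeightedHol v ℂ) (y : Fin n → F), g = ∑ i, tensor (h i) (y i) := by
  have : FiniteDimensional ℂ (Submodule.span ℂ (vRange v g.toFun)) := hg
  obtain ⟨n, y, c, -, hc⟩ := exists_finite_expansion (Submodule.span ℂ (vRange v g.toFun))
  refine ⟨n, fun i => comp (c i) g, y, ext_toFun (funext fun x => ?_)⟩
  rw [toFun_sum]
  refine (hc _ ?_).symm
  have h1 : (v.toFun x : ℂ) ≠ 0 := by exact_mod_cast (v.pos x).ne'
  have h2 : (v.toFun x : ℂ)⁻¹ • ((v.toFun x : ℂ) • g.toFun x) = g.toFun x :=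
    inv_smul_smul₀ h1 _
  rw [← h2]
  exact Submodule.smul_mem _ _ (Submodule.subset_span ⟨x, rfl⟩)

/-! ### From the approximation property to approximable maps -/

/-- The approximation property of `WeightedHol v ℂ` gives finite rank approximations of maps with
relatively compact `v`-range. -/
theorem exists_finiteRank_norm_sub_le (hAP : HasApproximationProperty (WeightedHol v ℂ))
    (f : WeightedHol v F) (hf : IsCompact (closure (vRange v f.toFun))) {ε : ℝ} (hε : 0 < ε) :
    ∃ g ∈ weightedHolFiniteRank v F, ‖g - f‖ ≤ ε := by
  have hK := isCompact_image_comp f hf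
  obtain ⟨T, hT, hTK⟩ := hAP _ hK (ε / 2) (by linarith)
  obtain ⟨n, h, c, -, hc⟩ := exists_finite_expansion (LinearMap.range T.toLinearMap)
  have hs : 0 ≤ ∑ i, ‖h i‖ := Finset.sum_nonneg fun i _ => norm_nonneg _
  have hδ : 0 < ε / (2 * (∑ i, ‖h i‖ + 1)) := by positivity
  have hy : ∀ i, ∃ y : F, ∀ φ : StrongDual ℂ F, ‖φ‖ ≤ 1 →
      ‖(c i).comp T (comp φ f) - φ y‖ ≤ ε / (2 * (∑ i, ‖h i‖ + 1)) := by
    intro i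
    obtain ⟨L, hL, hLK⟩ := exists_mem_span_eval_near_of_isCompact hK ((c i).comp T) hδ
    obtain ⟨y, hy⟩ := exists_apply_comp_eq f hL
    refine ⟨y, fun φ hφ => ?_⟩
    rw [← hy φ]
    exact hLK _ ⟨φ, by simpa using hφ, rfl⟩
  choose y hy using hy
  refine ⟨∑ i, tensor (h i) (y i), sum_tensor_mem_finiteRank h y,
    norm_le_of_forall_norm_comp_le hε.le fun φ hφ => ?_⟩
  have hsum : T (comp φ f) = ∑ i, (c i).comp T (comp φ f) • h i := (hc _ ⟨_, rfl⟩).symm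
  have heq : comp φ (∑ i, tensor (h i) (y i) - f)
      = (T (comp φ f) - comp φ f) - ∑ i, ((c i).comp T (comp φ f) - φ (y i)) • h i := by
    simp only [sub_smul, Finset.sum_sub_distrib, ← hsum, map_sub, map_sum, comp_tensor]
    abel
  rw [heq]
  have h1 := (hTK (comp φ f) ⟨φ, by simpa using hφ, rfl⟩).le
  have h2 : ‖∑ i, ((c i).comp T (comp φ f) - φ (y i)) • h i‖ ≤ ε / 2 := by
    calc _ ≤ ∑ i, ε / (2 * (∑ i, ‖h i‖ + 1)) * ‖h i‖ := norm_sum_le_of_le _ fun i _ => by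
          rw [norm_smul]
          exact mul_le_mul_of_nonneg_right (hy i φ hφ) (norm_nonneg _)
      _ = ε / (2 * (∑ i, ‖h i‖ + 1)) * ∑ i, ‖h i‖ := by rw [Finset.mul_sum]
      _ ≤ ε / (2 * (∑ i, ‖h i‖ + 1)) * (∑ i, ‖h i‖ + 1) := by gcongr; linarith
      _ = ε / 2 := by field_simp
  exact (norm_sub_le_of_le h1 h2).trans_eq (by ring)

theorem compact_subset_approximable (hAP : HasApproximationProperty (WeightedHol v ℂ)) :
    weightedHolCompact v F ⊆ weightedHolApproximable v F := by
  intro f hf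
  obtain ⟨f', rfl⟩ := exists_toFun_eq_of_mem_compact hf
  choose g hg hgf using fun n : ℕ =>
    exists_finiteRank_norm_sub_le hAP f' hf.2 (Nat.one_div_pos_of_nat (α := ℝ) (n := n))
  exact ⟨f', rfl, g, hg, squeeze_zero (fun n => norm_nonneg _) hgf
    tendsto_one_div_add_atTop_nhds_zero_nat⟩

/-! ### From approximable maps to the approximation property -/

/-- If maps with relatively compact `v`-range into the separable spaces are approximable then the
identity of `WeightedHol v ℂ` is approximated along each relatively compact sequence. -/
theorem exists_finiteRank_near_on_range
    (hb : ∀ (F : Type w) [NormedAddCommGroup F] [NormedSpace ℂ F] [CompleteSpace F],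
      weightedHolCompact v F ⊆ weightedHolApproximable v F)
    {K : Set (WeightedHol v ℂ)} (hK : IsCompact K) (p : ℕ → WeightedHol v ℂ) (hp : ∀ n, p n ∈ K)
    {ε : ℝ} (hε : 0 < ε) :
    ∃ T : WeightedHol v ℂ →L[ℂ] WeightedHol v ℂ,
      FiniteDimensional ℂ (LinearMap.range (T : WeightedHol v ℂ →ₗ[ℂ] WeightedHol v ℂ)) ∧
        ∀ n, ‖T (p n) - p n‖ ≤ ε := by
  obtain ⟨M, hM⟩ := hK.isBounded.exists_norm_le
  have hpM : ∀ n, ‖p n‖ ≤ M := fun n => hM _ (hp n)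
  have hM0 : 0 ≤ M := (norm_nonneg _).trans (hpM 0)
  have hle : ∀ (L : WeightedHol v ℂ →L[ℂ] ℂ) (n : ULift.{w} ℕ), ‖L (p n.down)‖ ≤ ‖L‖ * M :=
    fun L n => L.le_opNorm_of_le (hpM _)
  -- `ULift` places ℓ^∞ in the universe over which the hypothesis quantifies.
  let R : (WeightedHol v ℂ →L[ℂ] ℂ) →L[ℂ] (ULift.{w} ℕ →ᵇ ℂ) := LinearMap.mkContinuous
    { toFun := fun L => BoundedContinuousFunction.ofNormedAddCommGroupDiscrete
        (fun n : ULift.{w} ℕ => L (p n.down)) (‖L‖ * M) (hle L)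
      map_add' := fun _ _ => rfl
      map_smul' := fun _ _ => rfl } M fun L => by
    rw [BoundedContinuousFunction.norm_le (by positivity)]
    exact fun n => (hle L n).trans_eq (mul_comm _ _)
  have hRa : ∀ L n, R L n = L (p n.down) := fun L n => rfl
  -- Taking the closed range as target makes the vectors `y i` of the approximant limits of elements
  -- `R L`.
  let W : Submodule ℂ (ULift.{w} ℕ →ᵇ ℂ) := (LinearMap.range R.toLinearMap).topologicalClosure
  have hRW : ∀ L, R L ∈ W := fun L => Submodule.le_topologicalClosure _ ⟨L, rfl⟩
  have : CompleteSpace W := (Submodule.isClosed_topologicalClosure _).completeSpace_coe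
  let R' : (WeightedHol v ℂ →L[ℂ] ℂ) →L[ℂ] W := R.codRestrict W hRW
  let f : U → W := fun x => R' (eval v x)
  have hf : f ∈ weightedHolCompact v W := by
    refine ⟨⟨fun y => R' (evalExt v y),
      R'.differentiable.comp_differentiableOn differentiableOn_evalExt,
      fun x => congrArg R' (evalExt_coe x)⟩, ?_⟩
    refine (isCompact_image_dual_closedBall hK (fun L => R' L)
      fun φ ψ η hη h => ?_).closure_of_subset ?_
    · rw [Subtype.dist_eq, BoundedContinuousFunction.dist_le hη]
      intro n
      rw [dist_eq_norm]
      exact h _ (hp n.down)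
    · rintro _ ⟨x, rfl⟩
      refine ⟨(v.toFun x : ℂ) • eval v x, ?_, map_smul R' _ _⟩
      simpa using norm_smul_eval_le x
  obtain ⟨f', hf', g, hg, hlim⟩ := hb W hf
  obtain ⟨N, hN⟩ := (hlim.eventually (gt_mem_nhds (half_pos hε))).exists
  obtain ⟨m, h, y, hgy⟩ := exists_eq_sum_tensor (hg N)
  have hs : 0 ≤ ∑ i, ‖h i‖ := Finset.sum_nonneg fun i _ => norm_nonneg _
  have hη : 0 < ε / (2 * (∑ i, ‖h i‖ + 1)) := by positivity
  have hL : ∀ i, ∃ L, ‖R' L - y i‖ ≤ ε / (2 * (∑ i, ‖h i‖ + 1)) := by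
    intro i
    have hyi : (y i : ULift.{w} ℕ →ᵇ ℂ) ∈ closure (Set.range R) := (y i).2
    obtain ⟨_, ⟨L, rfl⟩, hL⟩ := Metric.mem_closure_iff.1 hyi _ hη
    refine ⟨L, ?_⟩
    rw [dist_comm, dist_eq_norm] at hL
    exact hL.le
  choose L hL using hL
  let T : WeightedHol v ℂ →L[ℂ] WeightedHol v ℂ := ∑ i, (L i).smulRight (h i)
  have hTa : ∀ k, T k = ∑ i, L i k • h i := fun k => by
    simp [T]
  refine ⟨T, ?_, fun n => ?_⟩
  · have hle : LinearMap.range (T : WeightedHol v ℂ →ₗ[ℂ] WeightedHol v ℂ)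
        ≤ Submodule.span ℂ (Set.range h) := by
      rintro _ ⟨k, rfl⟩
      rw [ContinuousLinearMap.coe_coe, hTa]
      exact Submodule.sum_mem _ fun i _ =>
        Submodule.smul_mem _ _ (Submodule.subset_span ⟨i, rfl⟩)
    have : FiniteDimensional ℂ (Submodule.span ℂ (Set.range h)) :=
      FiniteDimensional.span_of_finite ℂ (Set.finite_range h)
    exact Submodule.finiteDimensional_of_le hle
  let e : W →L[ℂ] ℂ := (BoundedContinuousFunction.evalCLM ℂ (ULift.up n)).comp W.subtypeL
  have he : ∀ u : W, ‖e u‖ ≤ ‖u‖ := fun u =>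
    BoundedContinuousFunction.norm_coe_le_norm (u : ULift.{w} ℕ →ᵇ ℂ) _
  have he1 : ‖e‖ ≤ 1 := e.opNorm_le_bound zero_le_one fun u =>
    (he u).trans_eq (one_mul _).symm
  have heR : ∀ L, e (R' L) = L (p n) := fun L => rfl
  have hef : comp e f' = p n := by
    refine ext_toFun (funext fun x => ?_)
    rw [comp_toFun, hf']
    rfl
  have heq : T (p n) - p n
      -- The first term is the error of replacing `y i` by `R' (L i)`, the second the n-th
      -- coordinate of the approximation error of `f'`; each costs at most ε/2, uniformly in n.
      = (∑ i, e (R' (L i) - y i) • h i) + comp e (g N - f') := by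
    rw [map_sub, hef, hgy, hTa]
    simp only [map_sub, map_sum, comp_tensor, sub_smul, Finset.sum_sub_distrib, heR]
    abel
  have h1 : ‖∑ i, e (R' (L i) - y i) • h i‖ ≤ ε / 2 := by
    calc _ ≤ ∑ i, ε / (2 * (∑ i, ‖h i‖ + 1)) * ‖h i‖ := norm_sum_le_of_le _ fun i _ => by
          rw [norm_smul]
          exact mul_le_mul_of_nonneg_right ((he _).trans (hL i)) (norm_nonneg _)
      _ = ε / (2 * (∑ i, ‖h i‖ + 1)) * ∑ i, ‖h i‖ := by rw [Finset.mul_sum]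
      _ ≤ ε / (2 * (∑ i, ‖h i‖ + 1)) * (∑ i, ‖h i‖ + 1) := by gcongr; linarith
      _ = ε / 2 := by field_simp
  rw [heq]
  exact (norm_add_le_of_le h1 ((norm_comp_le he1 _).trans hN.le)).trans_eq (by ring)

theorem hasApproximationProperty_of_compact_subset_approximable
    (hb : ∀ (F : Type w) [NormedAddCommGroup F] [NormedSpace ℂ F] [CompleteSpace F],
      weightedHolCompact v F ⊆ weightedHolApproximable v F) :
    HasApproximationProperty (WeightedHol v ℂ) := by
  intro K hK ε hε
  rcases K.eq_empty_or_nonempty with rfl | hne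
  · refine ⟨0, ?_, by simp⟩
    rw [ContinuousLinearMap.toLinearMap_zero, LinearMap.range_zero]
    infer_instance
  obtain ⟨p, hp, hKp⟩ := hK.exists_dense_range hne
  obtain ⟨T, hT, hTp⟩ := exists_finiteRank_near_on_range hb hK p hp (half_pos hε)
  exact ⟨T, hT, fun k hk =>
    (norm_apply_sub_le_of_mem_closure hTp (hKp hk)).trans_lt (half_lt_self hε)⟩

end WeightedHol

theorem mainTheorem11 {E : Type u} [NormedAddCommGroup E] [NormedSpace ℂ E]
    [CompleteSpace E] (U : Opens E) (v : Weight U) :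
    HasApproximationProperty (WeightedHol v ℂ) ↔
      ∀ (F : Type w) [NormedAddCommGroup F] [NormedSpace ℂ F] [CompleteSpace F],
        weightedHolCompact v F ⊆ weightedHolApproximable v F :=
  ⟨fun hAP _ _ _ _ => WeightedHol.compact_subset_approximable hAP,
    WeightedHol.hasApproximationProperty_of_compact_subset_approximable⟩
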